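/- Let $\Lambda$ be an Artin algebra, that is, an algebra over some commutative artinian ring $R$ which is finitely generated as an $R$-module. All modules are finitely generated left modules. Let $\Delta_{(0,0)}=\begin{pmatrix}\Lambda&\Lambda\\ \Lambda&\Lambda\end{pmatrix}$ be the ring of $2\times 2$ arrays over $\Lambda$ with entrywise addition and multiplication $$\begin{pmatrix}a&n\\ m&b\end{pmatrix}\begin{pmatrix}a'&n'\\ m'&b'\end{pmatrix}=\begin{pmatrix}aa'&an'+nb'\\ ma'+bm'&bb'\end{pmatrix}.$$ $\Delta_{(0,0)}$-modules are identified with tuples $(X,Y,f,g)$, where $X,Y$ are $\Lambda$-modules and $f\colon X\to Y$, $g\colon Y\to X$ are $\Lambda$-homomorphisms whose two composites are both zero; the tuple corresponds to the abelian group $X\oplus Y$ with $\begin{pmatrix}a&n\\ m&b\end{pmatrix}(x,y)=(ax+g(ny),\,by+f(mx))$. For a ring $A$, an $A$-module $M$ is called Gorenstein-projective if there is an exact sequence $\cdots\to P^{-1}\to P^0\to P^1\to\cdots$ of finitely generated projective $A$-modules, indexed by $\mathbb Z$, which remains exact after applying $\operatorname{Hom}_A(-,A)$, such that $M\cong\operatorname{Coker}(P^{-1}\to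 P^0)$. Let $(X,Y,f,g)$ be a $\Delta_{(0,0)}$-module such that $\operatorname{Im} f=\operatorname{Ker} g$, $\operatorname{Im} g=\operatorname{Ker} f$, and $\operatorname{Im} f$ is a Gorenstein-projective $\Lambda$-module. Then the following are equivalent: 1. $(X,Y,f,g)$ is a Gorenstein-projective $\Delta_{(0,0)}$-module; 2. $X$ and $Y$ are Gorenstein-projective $\Lambda$-modules; 3. $(Y,X,g,f)$ is a Gorenstein-projective $\Delta_{(0,0)}$-module. -/

import Mathlib

universe u v w r

/-- A totally acyclic complex over a ring `A`: an exact sequence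
`⋯ ⟶ P^i ⟶ P^{i+1} ⟶ P^{i+2} ⟶ ⋯`, indexed by `ℤ`, of finitely generated projective left
`A`-modules that remains exact after applying `Hom_A(-, A)`.
(A finitely generated `A`-module is isomorphic to a quotient of some `A ^ n`, so it is no
restriction to take the terms in the universe of `A`.) -/
structure TotallyAcyclicComplex (A : Type u) [Ring A] where
  /-- the terms `P^i` -/
  X : ℤ → Type u
  [addCommGroup : ∀ i, AddCommGroup (X i)]
  [module : ∀ i, Module A (X i)]
  finite : ∀ i, Module.Finite A (X i)
  projective : ∀ i, Module.Projective A (X i)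
  /-- the differentials `P^i ⟶ P^{i+1}` -/
  d : ∀ i, X i →ₗ[A] X (i + 1)
  exact : ∀ i, Function.Exact (d i) (d (i + 1))
  hom_exact : ∀ i, Function.Exact
    (fun φ : X (i + 1 + 1) →ₗ[A] A => φ ∘ₗ d (i + 1))
    (fun φ : X (i + 1) →ₗ[A] A => φ ∘ₗ d i)

attribute [instance] TotallyAcyclicComplex.addCommGroup TotallyAcyclicComplex.module

/-- `M` belongs to `Gproj A`: it is isomorphic to the cokernel of `P^{-1} ⟶ P^0` for some totally
acyclic complex of finitely generated projective `A`-modules. In particular `M` is then finitely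
generated. -/
def IsGorensteinProjective (A : Type u) [Ring A] (M : Type v) [AddCommGroup M] [Module A M] :
    Prop :=
  ∃ P : TotallyAcyclicComplex A,
    Nonempty (M ≃ₗ[A] (P.X (-1 + 1) ⧸ LinearMap.range (P.d (-1))))

/-- The Morita ring `Δ₍₀,₀₎` of `2 × 2` matrices
`(a n; m b)` with entries in `Λ`, entrywise addition and multiplication
`(a n; m b) (a' n'; m' b') = (aa'  an' + nb'; ma' + bm'  bb')`
(the bimodule homomorphisms `Λ ⊗ Λ → Λ` are both zero). -/
@[ext]
structure Delta (Λ : Type u) where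
  /-- upper left entry -/
  a : Λ
  /-- upper right entry -/
  n : Λ
  /-- lower left entry -/
  m : Λ
  /-- lower right entry -/
  b : Λ

namespace Delta

variable {Λ : Type u} [Ring Λ]

instance : Zero (Delta Λ) := ⟨⟨0, 0, 0, 0⟩⟩
instance : One (Delta Λ) := ⟨⟨1, 0, 0, 1⟩⟩
instance : Add (Delta Λ) := ⟨fun s t => ⟨s.a + t.a, s.n + t.n, s.m + t.m, s.b + t.b⟩⟩
instance : Neg (Delta Λ) := ⟨fun s => ⟨-s.a, -s.n, -s.m, -s.b⟩⟩
instance : Mul (Delta Λ) :=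
  ⟨fun s t => ⟨s.a * t.a, s.a * t.n + s.n * t.b, s.m * t.a + s.b * t.m, s.b * t.b⟩⟩

@[simp] theorem zero_a : (0 : Delta Λ).a = 0 := rfl
@[simp] theorem zero_n : (0 : Delta Λ).n = 0 := rfl
@[simp] theorem zero_m : (0 : Delta Λ).m = 0 := rfl
@[simp] theorem zero_b : (0 : Delta Λ).b = 0 := rfl
@[simp] theorem one_a : (1 : Delta Λ).a = 1 := rfl
@[simp] theorem one_n : (1 : Delta Λ).n = 0 := rfl
@[simp] theorem one_m : (1 : Delta Λ).m = 0 := rfl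
@[simp] theorem one_b : (1 : Delta Λ).b = 1 := rfl
@[simp] theorem add_a (s t : Delta Λ) : (s + t).a = s.a + t.a := rfl
@[simp] theorem add_n (s t : Delta Λ) : (s + t).n = s.n + t.n := rfl
@[simp] theorem add_m (s t : Delta Λ) : (s + t).m = s.m + t.m := rfl
@[simp] theorem add_b (s t : Delta Λ) : (s + t).b = s.b + t.b := rfl
@[simp] theorem neg_a (s : Delta Λ) : (-s).a = -s.a := rfl
@[simp] theorem neg_n (s : Delta Λ) : (-s).n = -s.n := rfl
@[simp] theorem neg_m (s : Delta Λ) : (-s).m = -s.m := rfl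
@[simp] theorem neg_b (s : Delta Λ) : (-s).b = -s.b := rfl
@[simp] theorem mul_a (s t : Delta Λ) : (s * t).a = s.a * t.a := rfl
@[simp] theorem mul_n (s t : Delta Λ) : (s * t).n = s.a * t.n + s.n * t.b := rfl
@[simp] theorem mul_m (s t : Delta Λ) : (s * t).m = s.m * t.a + s.b * t.m := rfl
@[simp] theorem mul_b (s t : Delta Λ) : (s * t).b = s.b * t.b := rfl

instance : Ring (Delta Λ) where
  add_assoc s t r := by ext <;> simp [add_assoc]
  zero_add s := by ext <;> simp
  add_zero s := by ext <;> simp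
  add_comm s t := by ext <;> simp [add_comm]
  neg_add_cancel s := by ext <;> simp
  mul_assoc s t r := by ext <;> simp [mul_assoc, mul_add, add_mul, add_assoc]
  one_mul s := by ext <;> simp
  mul_one s := by ext <;> simp
  zero_mul s := by ext <;> simp
  mul_zero s := by ext <;> simp
  left_distrib s t r := by ext <;> simp [mul_add] <;> abel
  right_distrib s t r := by ext <;> simp [add_mul] <;> abel
  nsmul := nsmulRec
  zsmul := zsmulRec

end Delta

/-- A tuple `(X, Y, f, g)`: homomorphisms `f : X → Y` and `g : Y → X` of left `Λ`-modules with both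
composites zero. (With `M = N = Λ`, the maps `M ⊗ X → Y` and `N ⊗ Y → X` describing a
module over a Morita ring are written as maps `X → Y` and `Y → X`.) -/
structure DeltaTuple (Λ : Type u) [Ring Λ] (X : Type v) [AddCommGroup X] [Module Λ X]
    (Y : Type w) [AddCommGroup Y] [Module Λ Y] where
  f : X →ₗ[Λ] Y
  g : Y →ₗ[Λ] X
  g_comp_f : g ∘ₗ f = 0
  f_comp_g : f ∘ₗ g = 0

namespace DeltaTuple

variable {Λ : Type u} [Ring Λ] {X : Type v} [AddCommGroup X] [Module Λ X]
  {Y : Type w} [AddCommGroup Y] [Module Λ Y]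

/-- The tuple `(Y, X, g, f)`. -/
def swap (T : DeltaTuple Λ X Y) : DeltaTuple Λ Y X where
  f := T.g
  g := T.f
  g_comp_f := T.f_comp_g
  f_comp_g := T.g_comp_f

/-- The `Δ₍₀,₀₎`-module defined by a tuple `(X, Y, f, g)`: the additive group `X ⊕ Y`, with
`(a n; m b) (x, y) = (a x + g (n y), b y + f (m x))`. -/
def Carrier (_T : DeltaTuple Λ X Y) : Type (max v w) := X × Y

instance (T : DeltaTuple Λ X Y) : AddCommGroup T.Carrier := inferInstanceAs (AddCommGroup (X × Y))

instance (T : DeltaTuple Λ X Y) : SMul (Delta Λ) T.Carrier :=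
  ⟨fun s p => ((s.a • p.1 + T.g (s.n • p.2), s.b • p.2 + T.f (s.m • p.1)) : X × Y)⟩

theorem smul_def (T : DeltaTuple Λ X Y) (s : Delta Λ) (p : T.Carrier) :
    s • p = ((s.a • p.1 + T.g (s.n • p.2), s.b • p.2 + T.f (s.m • p.1)) : X × Y) := rfl

theorem g_f (T : DeltaTuple Λ X Y) (x : X) : T.g (T.f x) = 0 :=
  LinearMap.congr_fun T.g_comp_f x

theorem f_g (T : DeltaTuple Λ X Y) (y : Y) : T.f (T.g y) = 0 :=
  LinearMap.congr_fun T.f_comp_g y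

instance (T : DeltaTuple Λ X Y) : Module (Delta Λ) T.Carrier where
  one_smul p := by
    refine Prod.ext ?_ ?_ <;> simp [smul_def]
  mul_smul s t p := by
    refine Prod.ext ?_ ?_
    · change (s.a * t.a) • p.1 + T.g ((s.a * t.n + s.n * t.b) • p.2) =
        s.a • (t.a • p.1 + T.g (t.n • p.2)) + T.g (s.n • (t.b • p.2 + T.f (t.m • p.1)))
      simp only [mul_smul, add_smul, smul_add, map_add, map_smul, g_f, smul_zero]; abel
    · change (s.b * t.b) • p.2 + T.f ((s.m * t.a + s.b * t.m) • p.1) =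
        s.b • (t.b • p.2 + T.f (t.m • p.1)) + T.f (s.m • (t.a • p.1 + T.g (t.n • p.2)))
      simp only [mul_smul, add_smul, smul_add, map_add, map_smul, f_g, smul_zero]; abel
  smul_zero s := by
    change ((s.a • (0 : X) + T.g (s.n • (0 : Y)), s.b • (0 : Y) + T.f (s.m • (0 : X))) : X × Y) = 0
    simp
  zero_smul p := by
    refine Prod.ext ?_ ?_
    · change (0 : Λ) • p.1 + T.g ((0 : Λ) • p.2) = (0 : X)
      simp
    · change (0 : Λ) • p.2 + T.f ((0 : Λ) • p.1) = (0 : Y)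
      simp
  smul_add s p q := by
    refine Prod.ext ?_ ?_
    · change s.a • (p.1 + q.1) + T.g (s.n • (p.2 + q.2)) =
        (s.a • p.1 + T.g (s.n • p.2)) + (s.a • q.1 + T.g (s.n • q.2))
      simp only [smul_add, map_add]; abel
    · change s.b • (p.2 + q.2) + T.f (s.m • (p.1 + q.1)) =
        (s.b • p.2 + T.f (s.m • p.1)) + (s.b • q.2 + T.f (s.m • q.1))
      simp only [smul_add, map_add]; abel
  add_smul s t p := by
    refine Prod.ext ?_ ?_
    · change (s.a + t.a) • p.1 + T.g ((s.n + t.n) • p.2) =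
        (s.a • p.1 + T.g (s.n • p.2)) + (t.a • p.1 + T.g (t.n • p.2))
      simp only [add_smul, map_add]; abel
    · change (s.b + t.b) • p.2 + T.f ((s.m + t.m) • p.1) =
        (s.b • p.2 + T.f (s.m • p.1)) + (t.b • p.2 + T.f (t.m • p.1))
      simp only [add_smul, map_add]; abel

end DeltaTuple

/-!
`Δ₍₀,₀₎` is a Frobenius extension of its diagonal `Λ × Λ`: the module induced from `(P, Q)` is the
module coinduced from `(Q, P)`, and both are given by the tuple `(P, P, id, 0) ⊕ (Q, Q, 0, id)`.
For this reason a tuple `(X, Y, f, g)` is Gorenstein-projective over `Δ₍₀,₀₎` exactly when `X` and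
`Y` are Gorenstein-projective over `Λ` (`DeltaTuple.isGorensteinProjective_carrier_iff`).
As this condition is symmetric in `X` and `Y`, it also characterizes the Gorenstein-projectivity of
`(Y, X, g, f)`.

Totally acyclic complexes are handled through short exact sequences `0 ⟶ M ⟶ P ⟶ N ⟶ 0` with `P`
finitely generated projective that stay exact under `Hom_A(-, A)` (`ProjStep`):
Gorenstein-projective modules are the terms of `ℤ`-indexed chains of such sequences, so a class of
modules closed under continuing to both sides consists of Gorenstein-projective modules
(`IsGorensteinProjective.of_coinduction`).

* From tuples to components: multiplying by a diagonal idempotent is an exact functor which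
  preserves finitely generated projectives. It also preserves `Hom`-exactness, since a functional on
  the corner `e N` coinduces a homomorphism `N ⟶ Δ₍₀,₀₎`. So it carries chains to chains
  (`Delta.isGorensteinProjective_corner`).
* From components to tuples: sequences `0 ⟶ X ⟶ P ⟶ X' ⟶ 0` and `0 ⟶ Y ⟶ Q ⟶ Y' ⟶ 0` give an
  embedding of the tuple into the tuple coinduced from `(P, Q)`. On the first component it is
  `X ⟶ P × Q`, whose second coordinate extends to `P`, so the cokernel is isomorphic to `X' × Q`
  and again Gorenstein-projective. The same happens on the second component, and dually for
  epimorphisms (`DeltaTuple.exists_right`, `DeltaTuple.exists_left`).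
-/

/-! ### Chains of short exact sequences with projective middle term -/

section Steps

variable {A : Type u} [Ring A]

/-- Every linear functional with values in the ring extends along `j`; that is, `Hom_A(j, A)` is
surjective. -/
def LinearMap.FunctionalsExtend {M : Type v} [AddCommGroup M] [Module A M]
    {P : Type w} [AddCommGroup P] [Module A P] (j : M →ₗ[A] P) : Prop :=
  ∀ φ : M →ₗ[A] A, ∃ ψ : P →ₗ[A] A, ψ ∘ₗ j = φ

/-- There is a short exact sequence `0 ⟶ M ⟶ P ⟶ N ⟶ 0` with `P` finitely generated projective
which stays exact under `Hom_A(-, A)`. As in `TotallyAcyclicComplex`, the middle term is taken in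
the universe of `A`. -/
def ProjStep (A : Type u) [Ring A] (M : Type v) [AddCommGroup M] [Module A M]
    (N : Type w) [AddCommGroup N] [Module A N] : Prop :=
  ∃ (P : Type u) (_ : AddCommGroup P) (_ : Module A P) (j : M →ₗ[A] P) (q : P →ₗ[A] N),
    Module.Finite A P ∧ Module.Projective A P ∧ Function.Injective j ∧ Function.Surjective q ∧
      Function.Exact j q ∧ j.FunctionalsExtend

theorem LinearMap.FunctionalsExtend.exists_extend {M : Type v} [AddCommGroup M] [Module A M]
    {P : Type w} [AddCommGroup P] [Module A P] {j : M →ₗ[A] P} (hj : j.FunctionalsExtend)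
    {Q : Type*} [AddCommGroup Q] [Module A Q] [Module.Finite A Q] [Module.Projective A Q]
    (φ : M →ₗ[A] Q) : ∃ ψ : P →ₗ[A] Q, ψ ∘ₗ j = φ := by
  obtain ⟨n, s, i, -, -, hsi⟩ := Module.Finite.exists_comp_eq_id_of_projective A Q
  choose ψ hψ using fun k : Fin n => hj (LinearMap.proj k ∘ₗ i ∘ₗ φ)
  refine ⟨s ∘ₗ LinearMap.pi ψ, ?_⟩
  have h : LinearMap.pi ψ ∘ₗ j = i ∘ₗ φ := by
    ext x k
    exact LinearMap.congr_fun (hψ k) x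
  rw [LinearMap.comp_assoc, h, ← LinearMap.comp_assoc, hsi, LinearMap.id_comp]

namespace ProjStep

variable {M : Type v} [AddCommGroup M] [Module A M] {N : Type w} [AddCommGroup N] [Module A N]

theorem congr_left {M' : Type*} [AddCommGroup M'] [Module A M'] (h : ProjStep A M N)
    (e : M' ≃ₗ[A] M) : ProjStep A M' N := by
  obtain ⟨P, _, _, j, q, hP, hP', hj, hq, hjq, hext⟩ := h
  refine ⟨P, _, _, j ∘ₗ e.toLinearMap, q, hP, hP', hj.comp e.injective, hq, ?_, ?_⟩
  · intro p
    rw [hjq p]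
    exact (e.surjective.range_comp j) ▸ Iff.rfl
  · intro φ
    obtain ⟨ψ, hψ⟩ := hext (φ ∘ₗ e.symm.toLinearMap)
    refine ⟨ψ, ?_⟩
    rw [← LinearMap.comp_assoc, hψ]
    ext x
    simp

theorem congr_right {N' : Type*} [AddCommGroup N'] [Module A N'] (h : ProjStep A M N)
    (e : N ≃ₗ[A] N') : ProjStep A M N' := by
  obtain ⟨P, _, _, j, q, hP, hP', hj, hq, hjq, hext⟩ := h
  refine ⟨P, _, _, j, e.toLinearMap ∘ₗ q, hP, hP', hj, e.surjective.comp hq, ?_, hext⟩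
  intro p
  rw [← hjq p]
  simp

theorem prod_left (h : ProjStep A M N) (Q : Type u) [AddCommGroup Q] [Module A Q]
    [Module.Finite A Q] [Module.Projective A Q] : ProjStep A (M × Q) N := by
  obtain ⟨P, _, _, j, q, hP, hP', hj, hq, hjq, hext⟩ := h
  refine ⟨P × Q, _, _, j.prodMap LinearMap.id, q ∘ₗ LinearMap.fst A P Q, inferInstance,
    inferInstance, hj.prodMap Function.injective_id, hq.comp Prod.fst_surjective, ?_, ?_⟩
  · rintro ⟨p, y⟩
    have := hjq p
    simp_all
  · intro φ
    obtain ⟨ψ, hψ⟩ := hext (φ ∘ₗ LinearMap.inl A M Q)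
    refine ⟨ψ.coprod (φ ∘ₗ LinearMap.inr A M Q), ?_⟩
    refine LinearMap.prod_ext (LinearMap.ext fun x => ?_) (LinearMap.ext fun y => ?_)
    · have : ψ (j x) = φ (x, 0) := LinearMap.congr_fun hψ x
      have h0 : φ (0, 0) = 0 := map_zero φ
      simp [this, h0]
    · simp

theorem prod_right (h : ProjStep A M N) (Q : Type u) [AddCommGroup Q] [Module A Q]
    [Module.Finite A Q] [Module.Projective A Q] : ProjStep A M (N × Q) := by
  obtain ⟨P, _, _, j, q, hP, hP', hj, hq, hjq, hext⟩ := h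
  refine ⟨P × Q, _, _, LinearMap.inl A P Q ∘ₗ j, q.prodMap LinearMap.id, inferInstance,
    inferInstance, (LinearMap.inl_injective).comp hj, hq.prodMap Function.surjective_id, ?_, ?_⟩
  · rintro ⟨p, y⟩
    have := hjq p
    simp_all [Prod.ext_iff, eq_comm]
  · intro φ
    obtain ⟨ψ, hψ⟩ := hext φ
    refine ⟨ψ ∘ₗ LinearMap.fst A P Q, ?_⟩
    ext x
    simpa using LinearMap.congr_fun hψ x

end ProjStep

/-- If a relation can be continued to the left and to the right of every element, then every
element lies on a chain indexed by `ℤ`. -/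
theorem exists_int_chain {S : Type*} (r : S → S → Prop) (hr : ∀ s, ∃ t, r s t)
    (hl : ∀ s, ∃ t, r t s) (s : S) (c : ℤ) :
    ∃ Z : ℤ → S, Z c = s ∧ ∀ i, r (Z i) (Z (i + 1)) := by
  choose next hnext using hr
  choose prev hprev using hl
  let Z : ℤ → S := fun i => Int.rec (fun n => next^[n] s) (fun n => prev^[n + 1] s) i
  have hZ : ∀ i, r (Z i) (Z (i + 1)) := by
    rintro (n | n | n)
    · change r (next^[n] s) (next^[n + 1] s)
      rw [Function.iterate_succ_apply']
      exact hnext _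
    · exact hprev s
    · change r (prev^[n + 1 + 1] s) (prev^[n + 1] s)
      rw [Function.iterate_succ_apply' prev (n + 1)]
      exact hprev _
  refine ⟨fun i => Z (i - c), ?_, fun i => ?_⟩
  · simp only [sub_self]
    rfl
  · have h := hZ (i - c)
    rwa [sub_add_eq_add_sub] at h

namespace IsGorensteinProjective

variable {M : Type v} [AddCommGroup M] [Module A M]

theorem congr {N : Type w} [AddCommGroup N] [Module A N] (h : IsGorensteinProjective A M)
    (e : N ≃ₗ[A] M) : IsGorensteinProjective A N := by
  obtain ⟨P, ⟨e'⟩⟩ := h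
  exact ⟨P, ⟨e.trans e'⟩⟩

/-- Splicing: the terms of a `ℤ`-indexed chain of `Hom_A(-, A)`-exact short exact sequences are
Gorenstein-projective. -/
theorem of_chain (Z : ℤ → ModuleCat.{u} A) (hZ : ∀ i, ProjStep A (Z i) (Z (i + 1))) :
    IsGorensteinProjective A (Z (-1 + 1 + 1)) := by
  choose P _ _ j q hP hP' hj hq hjq hext using hZ
  have hex : ∀ i, Function.Exact (j (i + 1) ∘ₗ q i) (j (i + 1 + 1) ∘ₗ q (i + 1)) := by
    intro i p
    rw [LinearMap.comp_apply, map_eq_zero_iff _ (hj _), hjq (i + 1) p, LinearMap.coe_comp,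
      (hq i).range_comp]
  refine ⟨{ X := P, finite := hP, projective := hP', d := fun i => j (i + 1) ∘ₗ q i,
            exact := hex, hom_exact := ?_ }, ⟨?_⟩⟩
  · intro i φ
    constructor
    · intro h
      have hφ : LinearMap.ker (q (i + 1)) ≤ LinearMap.ker φ := by
        intro p hp
        obtain ⟨z, rfl⟩ := (hjq (i + 1) p).1 hp
        obtain ⟨p', rfl⟩ := hq i z
        exact LinearMap.congr_fun h p'
      -- `φ` factors through the next syzygy, and the factor extends to the next projective
      let φ' := (LinearMap.ker (q (i + 1))).liftQ φ hφ ∘ₗ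
        ((q (i + 1)).quotKerEquivOfSurjective (hq _)).symm.toLinearMap
      obtain ⟨ψ, hψ⟩ := hext (i + 1 + 1) φ'
      refine ⟨ψ, ?_⟩
      ext p
      have h1 := LinearMap.congr_fun hψ (q (i + 1) p)
      have h2 : ((q (i + 1)).quotKerEquivOfSurjective (hq _)).symm (q (i + 1) p) =
          Submodule.Quotient.mk p := by
        rw [LinearEquiv.symm_apply_eq]
        rfl
      simp only [φ', LinearMap.comp_apply, LinearEquiv.coe_coe, h2] at h1
      exact h1
    · rintro ⟨ψ, rfl⟩
      ext p
      have := hex i ((j (i + 1) ∘ₗ q i) p)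
      have h0 := this.2 ⟨p, rfl⟩
      simp only [LinearMap.comp_apply] at h0 ⊢
      rw [h0, map_zero, LinearMap.zero_apply]
  · refine ((Submodule.quotEquivOfEq _ _ ?_).trans
      ((q (-1 + 1)).quotKerEquivOfSurjective (hq _))).symm
    ext p
    rw [LinearMap.mem_ker, hjq (-1 + 1) p]
    exact ((hq (-1)).range_comp (j (-1 + 1))) ▸ Iff.rfl

/-- A class of modules in which every member is both the left and the right end of a
`Hom_A(-, A)`-exact short exact sequence inside the class, with finitely generated projective
middle term, consists of Gorenstein-projective modules. -/
theorem of_coinduction (G : ModuleCat.{u} A → Prop)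
    (hr : ∀ M, G M → ∃ N, G N ∧ ProjStep A M N) (hl : ∀ M, G M → ∃ K, G K ∧ ProjStep A K M)
    (M : ModuleCat.{u} A) (hM : G M) : IsGorensteinProjective A M := by
  obtain ⟨Z, hZ, hstep⟩ := exists_int_chain
    (fun M N : {M : ModuleCat.{u} A // G M} => ProjStep A M.1 N.1)
    (fun M => let ⟨N, hN, h⟩ := hr M.1 M.2; ⟨⟨N, hN⟩, h⟩)
    (fun M => let ⟨N, hN, h⟩ := hl M.1 M.2; ⟨⟨N, hN⟩, h⟩) ⟨M, hM⟩ (-1 + 1 + 1)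
  have := of_chain (fun i => (Z i).1) hstep
  rwa [hZ] at this

/-- The kernels of the differentials of a totally acyclic complex form a chain of short exact
sequences. -/
theorem exists_chain (h : IsGorensteinProjective A M) :
    ∃ (Z : ℤ → ModuleCat.{u} A) (i : ℤ), (∀ i, ProjStep A (Z i) (Z (i + 1))) ∧
      Nonempty (M ≃ₗ[A] Z i) := by
  obtain ⟨P, ⟨e⟩⟩ := h
  have hd : ∀ i p, P.d i p ∈ LinearMap.ker (P.d (i + 1)) := fun i p =>
    (P.exact i _).2 ⟨p, rfl⟩
  have hsurj : ∀ i, Function.Surjective ((P.d i).codRestrict _ (hd i)) := by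
    rintro i ⟨y, hy⟩
    obtain ⟨p, rfl⟩ := (P.exact i y).1 hy
    exact ⟨p, rfl⟩
  refine ⟨fun i => ModuleCat.of A (LinearMap.ker (P.d i)), -1 + 1 + 1, fun i => ?_, ⟨?_⟩⟩
  · refine ⟨P.X i, _, _, (LinearMap.ker (P.d i)).subtype, (P.d i).codRestrict _ (hd i),
      P.finite i, P.projective i, Subtype.val_injective, hsurj i, ?_, ?_⟩
    · intro p
      simp [Subtype.ext_iff]
    · intro φ
      obtain ⟨l, rfl⟩ : ∃ l, i = l + 1 + 1 := ⟨i - 1 - 1, by ring⟩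
      obtain ⟨ψ, hψ⟩ := (P.hom_exact l (φ ∘ₗ (P.d (l + 1)).codRestrict _ (hd (l + 1)))).1 (by
        ext p
        have h0 : (P.d (l + 1)).codRestrict _ (hd (l + 1)) (P.d l p) = 0 :=
          Subtype.ext ((P.exact l _).2 ⟨p, rfl⟩)
        simp [h0])
      refine ⟨ψ, LinearMap.ext fun z => ?_⟩
      obtain ⟨p, rfl⟩ := hsurj (l + 1) z
      exact LinearMap.congr_fun hψ p
  · refine e.trans ((Submodule.quotEquivOfEq _ _ ?_).trans
      (((P.d (-1 + 1)).codRestrict _ (hd (-1 + 1))).quotKerEquivOfSurjective (hsurj _)))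
    rw [LinearMap.ker_codRestrict]
    exact ((LinearMap.exact_iff).1 (P.exact (-1))).symm

theorem of_chain_apply (Z : ℤ → ModuleCat.{u} A) (hZ : ∀ i, ProjStep A (Z i) (Z (i + 1)))
    (i : ℤ) : IsGorensteinProjective A (Z i) := by
  refine of_coinduction (fun N => ∃ i, N = Z i) ?_ ?_ _ ⟨i, rfl⟩
  · rintro _ ⟨i, rfl⟩
    exact ⟨_, ⟨i + 1, rfl⟩, hZ i⟩
  · rintro _ ⟨i, rfl⟩
    refine ⟨_, ⟨i - 1, rfl⟩, ?_⟩
    have := hZ (i - 1)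
    rwa [sub_add_cancel] at this

theorem exists_right (h : IsGorensteinProjective A M) :
    ∃ N : ModuleCat.{u} A, IsGorensteinProjective A N ∧ ProjStep A M N := by
  obtain ⟨Z, i, hZ, ⟨e⟩⟩ := h.exists_chain
  exact ⟨Z (i + 1), of_chain_apply Z hZ _, (hZ i).congr_left e⟩

theorem exists_left (h : IsGorensteinProjective A M) :
    ∃ K : ModuleCat.{u} A, IsGorensteinProjective A K ∧ ProjStep A K M := by
  obtain ⟨Z, i, hZ, ⟨e⟩⟩ := h.exists_chain
  refine ⟨Z (i - 1), of_chain_apply Z hZ _, ?_⟩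
  have := hZ (i - 1)
  rw [sub_add_cancel] at this
  exact this.congr_right e.symm

/-- A left and a right resolution of `M` splice at `M`. -/
theorem of_step_step {K L : Type u} [AddCommGroup K] [Module A K] [AddCommGroup L] [Module A L]
    {M : Type u} [AddCommGroup M] [Module A M]
    (hK : IsGorensteinProjective A K) (hKM : ProjStep A K M)
    (hL : IsGorensteinProjective A L) (hML : ProjStep A M L) : IsGorensteinProjective A M := by
  refine of_coinduction (fun N => IsGorensteinProjective A N ∨ N = ModuleCat.of A M) ?_ ?_
    (ModuleCat.of A M) (Or.inr rfl)
  · rintro N (hN | rfl)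
    · obtain ⟨N', hN', h⟩ := hN.exists_right
      exact ⟨N', Or.inl hN', h⟩
    · exact ⟨ModuleCat.of A L, Or.inl hL, hML⟩
  · rintro N (hN | rfl)
    · obtain ⟨N', hN', h⟩ := hN.exists_left
      exact ⟨N', Or.inl hN', h⟩
    · exact ⟨ModuleCat.of A K, Or.inl hK, hKM⟩

theorem prod_projective {M : Type u} [AddCommGroup M] [Module A M]
    (h : IsGorensteinProjective A M) (Q : Type u) [AddCommGroup Q] [Module A Q]
    [Module.Finite A Q] [Module.Projective A Q] : IsGorensteinProjective A (M × Q) := by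
  obtain ⟨N, hN, hMN⟩ := h.exists_right
  obtain ⟨K, hK, hKM⟩ := h.exists_left
  exact of_step_step hK (hKM.prod_right Q) hN (hMN.prod_left Q)

end IsGorensteinProjective

section Enlarge

variable {M N P Q : Type u} [AddCommGroup M] [Module A M] [AddCommGroup N] [Module A N]
  [AddCommGroup P] [Module A P] [AddCommGroup Q] [Module A Q]

theorem LinearMap.FunctionalsExtend.prod {j : M →ₗ[A] P} (hext : j.FunctionalsExtend)
    (t : M →ₗ[A] Q) : (j.prod t).FunctionalsExtend := by
  intro φ
  obtain ⟨ψ, hψ⟩ := hext φ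
  exact ⟨ψ ∘ₗ LinearMap.fst A P Q, by rw [LinearMap.comp_assoc, LinearMap.fst_prod, hψ]⟩

/-- Enlarging a monomorphism `M ⟶ P` by a map into a projective `Q` adds `Q` to the cokernel. -/
theorem IsGorensteinProjective.quotient_range_prod [Module.Finite A Q] [Module.Projective A Q]
    {j : M →ₗ[A] P} {q : P →ₗ[A] N} (hq : Function.Surjective q) (hjq : Function.Exact j q)
    (hext : j.FunctionalsExtend) (hN : IsGorensteinProjective A N) (t : M →ₗ[A] Q) :
    IsGorensteinProjective A ((P × Q) ⧸ LinearMap.range (j.prod t)) := by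
  -- an extension `h` of `t` to `P` makes `j.prod t` equivalent to `j.prod 0`
  obtain ⟨h, hh⟩ := hext.exists_extend t
  replace hh : ∀ x, h (j x) = t x := LinearMap.congr_fun hh
  let s : P × Q →ₗ[A] N × Q :=
    (q ∘ₗ LinearMap.fst A P Q).prod (LinearMap.snd A P Q - h ∘ₗ LinearMap.fst A P Q)
  have hs : Function.Surjective s := by
    rintro ⟨n, y⟩
    obtain ⟨p, rfl⟩ := hq n
    exact ⟨(p, y + h p), by simp [s]⟩
  refine (hN.prod_projective Q).congr
    ((Submodule.quotEquivOfEq _ _ ?_).trans (s.quotKerEquivOfSurjective hs))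
  ext ⟨p, y⟩
  have h1 : (p, y) ∈ LinearMap.range (j.prod t) ↔ ∃ x, j x = p ∧ t x = y := by
    simp
  have h2 : (p, y) ∈ LinearMap.ker s ↔ q p = 0 ∧ y = h p := by
    simp [s, sub_eq_zero]
  rw [h1, h2]
  constructor
  · rintro ⟨x, rfl, rfl⟩
    exact ⟨(hjq _).2 ⟨x, rfl⟩, (hh x).symm⟩
  · rintro ⟨hp, rfl⟩
    obtain ⟨x, rfl⟩ := (hjq _).1 hp
    exact ⟨x, rfl, (hh x).symm⟩

/-- Enlarging an epimorphism `P ⟶ N` by a map from a projective `Q` adds `Q` to the kernel, and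
keeps the extension property of the kernel. -/
theorem IsGorensteinProjective.ker_coprod [Module.Finite A Q] [Module.Projective A Q]
    {j : M →ₗ[A] P} {q : P →ₗ[A] N} (hj : Function.Injective j) (hq : Function.Surjective q)
    (hjq : Function.Exact j q) (hext : j.FunctionalsExtend) (hM : IsGorensteinProjective A M)
    (t : Q →ₗ[A] N) :
    IsGorensteinProjective A (LinearMap.ker (t.coprod q)) ∧
      (LinearMap.ker (t.coprod q)).subtype.FunctionalsExtend := by
  -- a lift `h` of `t` to `P` makes `t.coprod q` equivalent to `(0 : Q →ₗ N).coprod q`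
  obtain ⟨h, hh⟩ := Module.projective_lifting_property q t hq
  replace hh : ∀ x, q (h x) = t x := LinearMap.congr_fun hh
  have h0 : ∀ x, q (j x) = 0 := fun x => (hjq _).2 ⟨x, rfl⟩
  let s : M × Q →ₗ[A] LinearMap.ker (t.coprod q) :=
    LinearMap.codRestrict _ ((LinearMap.snd A M Q).prod
      (j ∘ₗ LinearMap.fst A M Q - h ∘ₗ LinearMap.snd A M Q)) (by
        rintro ⟨x, y⟩
        simp [hh, h0])
  have hs : ∀ x y, (s (x, y)).1 = (y, j x - h y) := fun x y => rfl
  have hinj : Function.Injective s := by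
    rintro ⟨x, y⟩ ⟨x', y'⟩ he
    have he' := congrArg Subtype.val he
    rw [hs, hs, Prod.mk.injEq] at he'
    obtain ⟨rfl, h2⟩ := he'
    rw [sub_left_inj] at h2
    rw [hj h2]
  have hsurj : Function.Surjective s := by
    rintro ⟨⟨y, p⟩, hp⟩
    rw [LinearMap.mem_ker, LinearMap.coprod_apply] at hp
    obtain ⟨x, hx⟩ := (hjq (p + h y)).1 (by rw [map_add, hh, add_comm]; exact hp)
    exact ⟨(x, y), Subtype.ext (by rw [hs, hx, add_sub_cancel_right])⟩
  refine ⟨(hM.prod_projective Q).congr (LinearEquiv.ofBijective s ⟨hinj, hsurj⟩).symm, ?_⟩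
  intro φ
  obtain ⟨ψ, hψ⟩ := hext (φ ∘ₗ s ∘ₗ LinearMap.inl A M Q)
  replace hψ : ∀ x, ψ (j x) = φ (s (x, 0)) := LinearMap.congr_fun hψ
  refine ⟨(φ ∘ₗ s ∘ₗ LinearMap.inr A M Q + ψ ∘ₗ h).coprod ψ, LinearMap.ext fun z => ?_⟩
  obtain ⟨⟨x, y⟩, rfl⟩ := hsurj z
  have e : ((x, y) : M × Q) = (x, 0) + (0, y) := by simp
  rw [LinearMap.comp_apply, Submodule.subtype_apply, hs, LinearMap.coprod_apply, e, map_add,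
    map_add, ← hψ x]
  simp
  abel

end Enlarge

end Steps

/-! ### Morphisms of tuples and coinduced tuples -/

namespace DeltaTuple

section Maps

variable {Λ : Type u} [Ring Λ] {X : Type v} [AddCommGroup X] [Module Λ X]
  {Y : Type w} [AddCommGroup Y] [Module Λ Y] {X' : Type*} [AddCommGroup X'] [Module Λ X']
  {Y' : Type*} [AddCommGroup Y'] [Module Λ Y']

/-- The homomorphism of `Δ₍₀,₀₎`-modules given by a morphism of tuples. -/
def mapCarrier (T : DeltaTuple Λ X Y) (T' : DeltaTuple Λ X' Y') (α : X →ₗ[Λ] X')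
    (β : Y →ₗ[Λ] Y') (hf : ∀ x, β (T.f x) = T'.f (α x)) (hg : ∀ y, α (T.g y) = T'.g (β y)) :
    T.Carrier →ₗ[Delta Λ] T'.Carrier where
  toFun p := ((α p.1, β p.2) : X' × Y')
  map_add' p q := by
    refine Prod.ext ?_ ?_
    · exact map_add α _ _
    · exact map_add β _ _
  map_smul' s p := by
    refine Prod.ext ?_ ?_
    · change α (s.a • p.1 + T.g (s.n • p.2)) = s.a • α p.1 + T'.g (s.n • β p.2)
      simp [hg]
    · change β (s.b • p.2 + T.f (s.m • p.1)) = s.b • β p.2 + T'.f (s.m • α p.1)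
      simp [hf]

/-- An isomorphism of tuples induces an isomorphism of `Δ₍₀,₀₎`-modules. -/
noncomputable def mapCarrierEquiv (T : DeltaTuple Λ X Y) (T' : DeltaTuple Λ X' Y')
    (α : X ≃ₗ[Λ] X')
    (β : Y ≃ₗ[Λ] Y') (hf : ∀ x, β (T.f x) = T'.f (α x)) (hg : ∀ y, α (T.g y) = T'.g (β y)) :
    T.Carrier ≃ₗ[Delta Λ] T'.Carrier :=
  LinearEquiv.ofBijective (mapCarrier T T' α.toLinearMap β.toLinearMap hf hg)
    ⟨α.injective.prodMap β.injective, α.surjective.prodMap β.surjective⟩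

/-- The homomorphism `(X, Y, f, g) ⟶ Δ₍₀,₀₎` given by functionals on `X` and on `Y`. The left
regular module is coinduced from its `n` and `m` entries, so that every homomorphism is of this
form. -/
def toDelta (T : DeltaTuple Λ X Y) (α : X →ₗ[Λ] Λ) (β : Y →ₗ[Λ] Λ) :
    T.Carrier →ₗ[Delta Λ] Delta Λ where
  toFun p := ⟨β (T.f p.1), α p.1, β p.2, α (T.g p.2)⟩
  map_add' p q := by
    change (⟨β (T.f (p.1 + q.1)), α (p.1 + q.1), β (p.2 + q.2), α (T.g (p.2 + q.2))⟩ : Delta Λ) = _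
    ext <;> simp
  map_smul' s p := by
    change (⟨β (T.f (s.a • p.1 + T.g (s.n • p.2))), α (s.a • p.1 + T.g (s.n • p.2)),
      β (s.b • p.2 + T.f (s.m • p.1)), α (T.g (s.b • p.2 + T.f (s.m • p.1)))⟩ : Delta Λ) = _
    ext <;> simp [f_g, g_f, add_comm]

theorem exists_eq_toDelta (T : DeltaTuple Λ X Y) (φ : T.Carrier →ₗ[Delta Λ] Delta Λ) :
    ∃ α β, φ = T.toDelta α β := by
  have hs : ∀ (s : Delta Λ) x y, φ ((s.a • x + T.g (s.n • y), s.b • y + T.f (s.m • x)) : X × Y) =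
      s * φ ((x, y) : X × Y) := fun s x y => φ.map_smul s ((x, y) : X × Y)
  have hadd : ∀ x x' y y', φ ((x + x', y + y') : X × Y) = φ ((x, y) : X × Y) +
      φ ((x', y') : X × Y) := fun x x' y y' => φ.map_add ((x, y) : X × Y) ((x', y') : X × Y)
  refine ⟨{ toFun := fun x => (φ ((x, 0) : X × Y)).n, map_add' := ?_, map_smul' := ?_ },
    { toFun := fun y => (φ ((0, y) : X × Y)).m, map_add' := ?_, map_smul' := ?_ }, ?_⟩
  · intro x x'
    simpa using congrArg Delta.n (hadd x x' 0 0)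
  · intro c x
    simpa using congrArg Delta.n (hs ⟨c, 0, 0, 0⟩ x 0)
  · intro y y'
    simpa using congrArg Delta.m (hadd 0 0 y y')
  · intro c y
    simpa using congrArg Delta.m (hs ⟨0, 0, 0, c⟩ 0 y)
  · refine LinearMap.ext fun p => ?_
    obtain ⟨x, y⟩ := p
    have h := hadd x 0 0 y
    have h1 := hs ⟨1, 0, 0, 0⟩ x 0
    have h2 := hs ⟨0, 0, 1, 0⟩ x 0
    have h3 := hs ⟨0, 0, 0, 1⟩ 0 y
    have h4 := hs ⟨0, 1, 0, 0⟩ 0 y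
    simp only [zero_smul, one_smul, smul_zero, map_zero, add_zero, zero_add] at h h1 h2 h3 h4
    change φ ((x, y) : X × Y) = ⟨(φ ((0, T.f x) : X × Y)).m, (φ ((x, 0) : X × Y)).n,
      (φ ((0, y) : X × Y)).m, (φ ((T.g y, 0) : X × Y)).n⟩
    rw [h, h2, h4]
    have e1 : (φ ((x, 0) : X × Y)).m = 0 := by rw [h1]; simp
    have e2 : (φ ((x, 0) : X × Y)).b = 0 := by rw [h1]; simp
    have e3 : (φ ((0, y) : X × Y)).a = 0 := by rw [h3]; simp
    have e4 : (φ ((0, y) : X × Y)).n = 0 := by rw [h3]; simp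
    ext <;> simp [e1, e2, e3, e4]

theorem functionalsExtend_mapCarrier {T : DeltaTuple Λ X Y} {T' : DeltaTuple Λ X' Y'}
    {α : X →ₗ[Λ] X'} {β : Y →ₗ[Λ] Y'} (hf : ∀ x, β (T.f x) = T'.f (α x))
    (hg : ∀ y, α (T.g y) = T'.g (β y)) (hα : α.FunctionalsExtend) (hβ : β.FunctionalsExtend) :
    (mapCarrier T T' α β hf hg).FunctionalsExtend := by
  intro φ
  obtain ⟨a, b, rfl⟩ := exists_eq_toDelta T φ
  obtain ⟨a', rfl⟩ := hα a
  obtain ⟨b', rfl⟩ := hβ b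
  refine ⟨T'.toDelta a' b', LinearMap.ext fun p => ?_⟩
  change (⟨b' (T'.f (α p.1)), a' (α p.1), b' (β p.2), a' (T'.g (β p.2))⟩ : Delta Λ) =
    ⟨b' (β (T.f p.1)), a' (α p.1), b' (β p.2), a' (α (T.g p.2))⟩
  rw [hf, hg]

/-- Short exact sequences of tuples may be checked componentwise. -/
theorem projStep_carrier {X Y X₁ Y₁ X₂ Y₂ : Type u}
    [AddCommGroup X] [Module Λ X] [AddCommGroup Y] [Module Λ Y]
    [AddCommGroup X₁] [Module Λ X₁] [AddCommGroup Y₁] [Module Λ Y₁]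
    [AddCommGroup X₂] [Module Λ X₂] [AddCommGroup Y₂] [Module Λ Y₂]
    {T : DeltaTuple Λ X Y} {W : DeltaTuple Λ X₁ Y₁} {T' : DeltaTuple Λ X₂ Y₂}
    [Module.Finite (Delta Λ) W.Carrier] [Module.Projective (Delta Λ) W.Carrier]
    {α : X →ₗ[Λ] X₁} {β : Y →ₗ[Λ] Y₁} (hf : ∀ x, β (T.f x) = W.f (α x))
    (hg : ∀ y, α (T.g y) = W.g (β y)) {α' : X₁ →ₗ[Λ] X₂} {β' : Y₁ →ₗ[Λ] Y₂}
    (hf' : ∀ x, β' (W.f x) = T'.f (α' x)) (hg' : ∀ y, α' (W.g y) = T'.g (β' y))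
    (hα : Function.Injective α) (hβ : Function.Injective β)
    (hα' : Function.Surjective α') (hβ' : Function.Surjective β')
    (hαα' : Function.Exact α α') (hββ' : Function.Exact β β')
    (hαe : α.FunctionalsExtend) (hβe : β.FunctionalsExtend) :
    ProjStep (Delta Λ) T.Carrier T'.Carrier := by
  refine ⟨W.Carrier, _, _, mapCarrier T W α β hf hg, mapCarrier W T' α' β' hf' hg',
    inferInstance, inferInstance, hα.prodMap hβ, hα'.prodMap hβ', ?_,
    functionalsExtend_mapCarrier hf hg hαe hβe⟩
  rintro ⟨x, y⟩
  have h1 := hαα' x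
  have h2 := hββ' y
  constructor
  · intro h
    obtain ⟨x', rfl⟩ := h1.1 (congrArg Prod.fst h)
    obtain ⟨y', rfl⟩ := h2.1 (congrArg Prod.snd h)
    exact ⟨((x', y') : X × Y), rfl⟩
  · rintro ⟨⟨x', y'⟩, h⟩
    exact Prod.ext (h1.2 ⟨x', congrArg Prod.fst h⟩) (h2.2 ⟨y', congrArg Prod.snd h⟩)

end Maps

section Cofree

variable {Λ : Type u} [Ring Λ]

/-- The tuple `(P, P, 0, id) ⊕ (Q, Q, id, 0)`. It is coinduced from `(P, Q)` and induced from
`(Q, P)`. -/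
def cofree (Λ : Type u) [Ring Λ] (P : Type v) [AddCommGroup P] [Module Λ P] (Q : Type w)
    [AddCommGroup Q] [Module Λ Q] : DeltaTuple Λ (P × Q) (Q × P) where
  f := LinearMap.inl Λ Q P ∘ₗ LinearMap.snd Λ P Q
  g := LinearMap.inl Λ P Q ∘ₗ LinearMap.snd Λ Q P
  g_comp_f := by ext <;> simp
  f_comp_g := by ext <;> simp

/-- The tuple coinduced from `(Λⁿ, Λⁿ)` is the free module of rank `n`. -/
def cofreeEquiv (Λ : Type u) [Ring Λ] (n : ℕ) :
    (Fin n → Delta Λ) ≃ₗ[Delta Λ] (cofree Λ (Fin n → Λ) (Fin n → Λ)).Carrier where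
  toFun s := (((fun i => (s i).n, fun i => (s i).a), (fun i => (s i).m, fun i => (s i).b)) :
    ((Fin n → Λ) × (Fin n → Λ)) × ((Fin n → Λ) × (Fin n → Λ)))
  invFun p := fun i => ⟨p.1.2 i, p.1.1 i, p.2.1 i, p.2.2 i⟩
  left_inv s := rfl
  right_inv p := rfl
  map_add' s t := rfl
  map_smul' c s := by
    refine Prod.ext (Prod.ext ?_ ?_) (Prod.ext ?_ ?_)
    · funext i
      rfl
    · funext i
      exact (add_zero _).symm
    · funext i
      exact add_comm _ _
    · funext i
      exact (add_zero _).symm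

theorem cofree_finite_projective (P Q : Type u) [AddCommGroup P] [Module Λ P] [AddCommGroup Q]
    [Module Λ Q] [Module.Finite Λ P] [Module.Projective Λ P] [Module.Finite Λ Q]
    [Module.Projective Λ Q] :
    Module.Finite (Delta Λ) (cofree Λ P Q).Carrier ∧
      Module.Projective (Delta Λ) (cofree Λ P Q).Carrier := by
  -- `P` and `Q` are retracts of the same free module
  obtain ⟨n, s, i, -, -, hsi⟩ := Module.Finite.exists_comp_eq_id_of_projective Λ (P × Q)
  replace hsi : ∀ z, s (i z) = z := LinearMap.congr_fun hsi
  let F := cofree Λ (Fin n → Λ) (Fin n → Λ)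
  let iP := i ∘ₗ LinearMap.inl Λ P Q
  let iQ := i ∘ₗ LinearMap.inr Λ P Q
  let sP := LinearMap.fst Λ P Q ∘ₗ s
  let sQ := LinearMap.snd Λ P Q ∘ₗ s
  let ι : (cofree Λ P Q).Carrier →ₗ[Delta Λ] F.Carrier :=
    mapCarrier _ _ (iP.prodMap iQ) (iQ.prodMap iP) (fun x => by simp [F, cofree])
      (fun x => by simp [F, cofree])
  let σ : F.Carrier →ₗ[Delta Λ] (cofree Λ P Q).Carrier :=
    mapCarrier _ _ (sP.prodMap sQ) (sQ.prodMap sP) (fun x => by simp [F, cofree])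
      (fun x => by simp [F, cofree])
  have h : σ ∘ₗ ι = LinearMap.id := by
    refine LinearMap.ext fun p => ?_
    obtain ⟨⟨x, y⟩, ⟨y', x'⟩⟩ := p
    change (((sP (iP x), sQ (iQ y)), (sQ (iQ y'), sP (iP x'))) : (P × Q) × (Q × P)) =
      ((x, y), (y', x'))
    simp [sP, sQ, iP, iQ, hsi]
  have hF : Module.Finite (Delta Λ) F.Carrier := Module.Finite.equiv (cofreeEquiv Λ n)
  have hF' : Module.Projective (Delta Λ) F.Carrier :=
    Module.Projective.of_equiv (cofreeEquiv Λ n)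
  exact ⟨Module.Finite.of_surjective σ fun p => ⟨ι p, LinearMap.congr_fun h p⟩,
    Module.Projective.of_split ι σ h⟩

variable {X Y : Type u} [AddCommGroup X] [Module Λ X] [AddCommGroup Y] [Module Λ Y]

/-- If `X ⟶ P` and `Y ⟶ Q` start the right resolutions of the components, then the adjoint map
embeds the tuple into the tuple coinduced from `(P, Q)`; on components, this enlarges the two
embeddings by maps into `Q` and `P`. -/
theorem exists_right (T : DeltaTuple Λ X Y) (hX : IsGorensteinProjective Λ X)
    (hY : IsGorensteinProjective Λ Y) :
    ∃ (X' Y' : ModuleCat.{u} Λ) (T' : DeltaTuple Λ X' Y'), IsGorensteinProjective Λ X' ∧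
      IsGorensteinProjective Λ Y' ∧ ProjStep (Delta Λ) T.Carrier T'.Carrier := by
  obtain ⟨M, hM, P, _, _, j, q, _, _, hj, hq, hjq, hext⟩ := hX.exists_right
  obtain ⟨N, hN, Q, _, _, k, t, _, _, hk, ht, hkt, hext'⟩ := hY.exists_right
  let α := j.prod (k ∘ₗ T.f)
  let β := k.prod (j ∘ₗ T.g)
  let W := cofree Λ P Q
  have hf : ∀ x, β (T.f x) = W.f (α x) := fun x => by simp [α, β, W, cofree, g_f]
  have hg : ∀ y, α (T.g y) = W.g (β y) := fun x => by simp [α, β, W, cofree, f_g]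
  obtain ⟨_, _⟩ := cofree_finite_projective (Λ := Λ) P Q
  let T' : DeltaTuple Λ ((P × Q) ⧸ LinearMap.range α) ((Q × P) ⧸ LinearMap.range β) :=
    { f := Submodule.mapQ _ _ W.f (by rintro _ ⟨x, rfl⟩; exact ⟨T.f x, hf x⟩)
      g := Submodule.mapQ _ _ W.g (by rintro _ ⟨y, rfl⟩; exact ⟨T.g y, hg y⟩)
      g_comp_f := by
        refine Submodule.linearMap_qext _ (LinearMap.ext fun x => ?_)
        exact (congrArg (Submodule.Quotient.mk) (W.g_f x)).trans (Submodule.Quotient.mk_zero _)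
      f_comp_g := by
        refine Submodule.linearMap_qext _ (LinearMap.ext fun x => ?_)
        exact (congrArg (Submodule.Quotient.mk) (W.f_g x)).trans (Submodule.Quotient.mk_zero _) }
  refine ⟨ModuleCat.of Λ _, ModuleCat.of Λ _, T', hM.quotient_range_prod hq hjq hext _,
    hN.quotient_range_prod ht hkt hext' _, ?_⟩
  refine projStep_carrier (W := W) (α' := Submodule.mkQ _) (β' := Submodule.mkQ _) hf hg
    (fun _ => rfl) (fun _ => rfl) ?_ ?_ (Submodule.mkQ_surjective _) (Submodule.mkQ_surjective _)
    (LinearMap.exact_map_mkQ_range α) (LinearMap.exact_map_mkQ_range β) (hext.prod _)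
    (hext'.prod _)
  · intro x y h
    exact hj (congrArg Prod.fst h)
  · intro x y h
    exact hk (congrArg Prod.fst h)

/-- If `P ⟶ X` and `Q ⟶ Y` start the left resolutions of the components, then the adjoint map
from the tuple induced from `(P, Q)` is onto; on components, this enlarges the two epimorphisms by
maps out of `Q` and `P`. -/
theorem exists_left (T : DeltaTuple Λ X Y) (hX : IsGorensteinProjective Λ X)
    (hY : IsGorensteinProjective Λ Y) :
    ∃ (X' Y' : ModuleCat.{u} Λ) (T' : DeltaTuple Λ X' Y'), IsGorensteinProjective Λ X' ∧
      IsGorensteinProjective Λ Y' ∧ ProjStep (Delta Λ) T'.Carrier T.Carrier := by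
  obtain ⟨M, hM, P, _, _, j, q, _, _, hj, hq, hjq, hext⟩ := hX.exists_left
  obtain ⟨N, hN, Q, _, _, k, t, _, _, hk, ht, hkt, hext'⟩ := hY.exists_left
  let α := (T.g ∘ₗ t).coprod q
  let β := (T.f ∘ₗ q).coprod t
  let W := cofree Λ Q P
  have hf : ∀ x, β (W.f x) = T.f (α x) := fun x => by simp [α, β, W, cofree, f_g]
  have hg : ∀ y, α (W.g y) = T.g (β y) := fun x => by simp [α, β, W, cofree, g_f]
  obtain ⟨_, _⟩ := cofree_finite_projective (Λ := Λ) Q P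
  let T' : DeltaTuple Λ (LinearMap.ker α) (LinearMap.ker β) :=
    { f := W.f.restrict fun x hx => by
        rw [LinearMap.mem_ker] at hx ⊢
        rw [hf, hx, map_zero]
      g := W.g.restrict fun y hy => by
        rw [LinearMap.mem_ker] at hy ⊢
        rw [hg, hy, map_zero]
      g_comp_f := LinearMap.ext fun x => Subtype.ext (W.g_f x.1)
      f_comp_g := LinearMap.ext fun y => Subtype.ext (W.f_g y.1) }
  obtain ⟨h1, h2⟩ := hM.ker_coprod hj hq hjq hext (T.g ∘ₗ t)
  obtain ⟨h3, h4⟩ := hN.ker_coprod hk ht hkt hext' (T.f ∘ₗ q)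
  refine ⟨ModuleCat.of Λ _, ModuleCat.of Λ _, T', h1, h3, ?_⟩
  refine projStep_carrier (W := W) (α := Submodule.subtype _) (β := Submodule.subtype _)
    (fun _ => rfl) (fun _ => rfl) hf hg Subtype.val_injective Subtype.val_injective ?_ ?_
    (LinearMap.exact_subtype_ker_map α) (LinearMap.exact_subtype_ker_map β) h2 h4
  · intro x
    obtain ⟨p, rfl⟩ := hq x
    exact ⟨(0, p), by simp [α]⟩
  · intro y
    obtain ⟨p, rfl⟩ := ht y
    exact ⟨(0, p), by simp [β]⟩

theorem isGorensteinProjective_carrier_aux (T : DeltaTuple Λ X Y)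
    (hX : IsGorensteinProjective Λ X) (hY : IsGorensteinProjective Λ Y) :
    IsGorensteinProjective (Delta Λ) T.Carrier := by
  refine IsGorensteinProjective.of_coinduction
    (fun N => ∃ (X Y : ModuleCat.{u} Λ) (T : DeltaTuple Λ X Y), IsGorensteinProjective Λ X ∧
      IsGorensteinProjective Λ Y ∧ N = ModuleCat.of (Delta Λ) T.Carrier) ?_ ?_
    (ModuleCat.of (Delta Λ) T.Carrier) ⟨ModuleCat.of Λ X, ModuleCat.of Λ Y, T, hX, hY, rfl⟩
  · rintro _ ⟨X, Y, T, hX, hY, rfl⟩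
    obtain ⟨X', Y', T', hX', hY', h⟩ := T.exists_right hX hY
    exact ⟨_, ⟨X', Y', T', hX', hY', rfl⟩, h⟩
  · rintro _ ⟨X, Y, T, hX, hY, rfl⟩
    obtain ⟨X', Y', T', hX', hY', h⟩ := T.exists_left hX hY
    exact ⟨_, ⟨X', Y', T', hX', hY', rfl⟩, h⟩

end Cofree

theorem isGorensteinProjective_carrier {Λ : Type u} [Ring Λ] {X : Type v} [AddCommGroup X]
    [Module Λ X] {Y : Type w} [AddCommGroup Y] [Module Λ Y] (T : DeltaTuple Λ X Y)
    (hX : IsGorensteinProjective Λ X) (hY : IsGorensteinProjective Λ Y) :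
    IsGorensteinProjective (Delta Λ) T.Carrier := by
  -- transport the tuple to modules in the universe of `Λ`
  obtain ⟨P, ⟨a⟩⟩ := id hX
  obtain ⟨Q, ⟨b⟩⟩ := id hY
  let T' : DeltaTuple Λ (P.X (-1 + 1) ⧸ LinearMap.range (P.d (-1)))
      (Q.X (-1 + 1) ⧸ LinearMap.range (Q.d (-1))) :=
    { f := b.toLinearMap ∘ₗ T.f ∘ₗ a.symm.toLinearMap
      g := a.toLinearMap ∘ₗ T.g ∘ₗ b.symm.toLinearMap
      g_comp_f := LinearMap.ext fun x => by simp [g_f]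
      f_comp_g := LinearMap.ext fun x => by simp [f_g] }
  exact (T'.isGorensteinProjective_carrier_aux (hX.congr a.symm) (hY.congr b.symm)).congr
    (mapCarrierEquiv T T' a b (fun x => by simp [T']) (fun y => by simp [T']))

end DeltaTuple

/-! ### Corners of modules over the Morita ring -/

namespace Delta

variable {Λ : Type u} [Ring Λ]

/-- The automorphism of `Δ₍₀,₀₎` exchanging the two diagonal idempotents. -/
def swapEquiv (Λ : Type u) [Ring Λ] : Delta Λ ≃+* Delta Λ where
  toFun s := ⟨s.b, s.m, s.n, s.a⟩
  invFun s := ⟨s.b, s.m, s.n, s.a⟩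
  left_inv _ := rfl
  right_inv _ := rfl
  map_mul' s t := by ext <;> simp [add_comm]
  map_add' s t := by ext <;> simp

/-- The additive group `e N`, for a `Δ₍₀,₀₎`-module `N` and the idempotent `e = σ (1 0; 0 0)`.
The automorphism `σ` serves to treat both diagonal idempotents at once. -/
def corner (σ : Delta Λ ≃+* Delta Λ) (N : Type v) [AddCommGroup N] [Module (Delta Λ) N] :
    AddSubgroup N where
  carrier := {x | σ ⟨1, 0, 0, 0⟩ • x = x}
  zero_mem' := smul_zero _
  add_mem' {x y} hx hy := by
    change _ • _ = _ at hx hy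
    change _ • _ = _
    rw [smul_add, hx, hy]
  neg_mem' {x} hx := by
    change _ • _ = _ at hx
    change _ • _ = _
    rw [smul_neg, hx]

section Corner

variable (σ : Delta Λ ≃+* Delta Λ) {N : Type v} [AddCommGroup N] [Module (Delta Λ) N]
  {N' : Type w} [AddCommGroup N'] [Module (Delta Λ) N']

theorem smul_mem_corner (a n : Λ) (x : N) : σ ⟨a, n, 0, 0⟩ • x ∈ corner σ N := by
  change _ • _ • _ = _
  rw [smul_smul, ← map_mul]
  congr 2
  ext <;> simp

/-- `Λ` acts on `e N` through its upper left copy in `Δ₍₀,₀₎`, twisted by `σ`. -/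
instance : Module Λ (corner σ N) where
  smul c x := ⟨σ ⟨c, 0, 0, 0⟩ • x.1, smul_mem_corner σ c 0 x.1⟩
  one_smul x := Subtype.ext x.2
  mul_smul c d x := by
    refine Subtype.ext ?_
    change σ ⟨c * d, 0, 0, 0⟩ • x.1 = σ ⟨c, 0, 0, 0⟩ • σ ⟨d, 0, 0, 0⟩ • x.1
    rw [smul_smul, ← map_mul]
    congr 2
    ext <;> simp
  smul_zero c := Subtype.ext (smul_zero _)
  zero_smul x := by
    refine Subtype.ext ?_
    change σ 0 • x.1 = 0
    rw [map_zero, zero_smul]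
  smul_add c x y := Subtype.ext (smul_add _ _ _)
  add_smul c d x := by
    refine Subtype.ext ?_
    change σ ⟨c + d, 0, 0, 0⟩ • x.1 = σ ⟨c, 0, 0, 0⟩ • x.1 + σ ⟨d, 0, 0, 0⟩ • x.1
    rw [← add_smul, ← map_add]
    congr 2
    ext <;> simp

theorem corner_smul_coe (c : Λ) (x : corner σ N) :
    ((c • x : corner σ N) : N) = σ ⟨c, 0, 0, 0⟩ • (x : N) := rfl

/-- The restriction of a homomorphism to the corners. -/
def cornerMap (φ : N →ₗ[Delta Λ] N') : corner σ N →ₗ[Λ] corner σ N' where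
  toFun x := ⟨φ x.1, (φ.map_smul _ _).symm.trans (congrArg φ x.2)⟩
  map_add' _ _ := Subtype.ext (map_add φ _ _)
  map_smul' _ _ := Subtype.ext (φ.map_smul _ _)

theorem cornerMap_injective {φ : N →ₗ[Delta Λ] N'} (h : Function.Injective φ) :
    Function.Injective (cornerMap σ φ) := fun _ _ hxy =>
  Subtype.ext (h (congrArg Subtype.val hxy))

/-- Preimages of elements of the corner may be moved into the corner by the idempotent. -/
theorem exists_mem_corner {φ : N →ₗ[Delta Λ] N'} {y : N'} (hy : y ∈ corner σ N')
    (h : y ∈ Set.range φ) : ∃ x : corner σ N, φ x = y := by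
  obtain ⟨x, rfl⟩ := h
  exact ⟨⟨_, smul_mem_corner σ 1 0 x⟩, (φ.map_smul _ _).trans hy⟩

theorem cornerMap_surjective {φ : N →ₗ[Delta Λ] N'} (h : Function.Surjective φ) :
    Function.Surjective (cornerMap σ φ) := fun y =>
  let ⟨x, hx⟩ := exists_mem_corner σ y.2 (h y.1)
  ⟨x, Subtype.ext hx⟩

theorem cornerMap_exact {N'' : Type*} [AddCommGroup N''] [Module (Delta Λ) N'']
    {φ : N →ₗ[Delta Λ] N'} {ψ : N' →ₗ[Delta Λ] N''} (h : Function.Exact φ ψ) :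
    Function.Exact (cornerMap σ φ) (cornerMap σ ψ) := by
  intro y
  constructor
  · intro hy
    obtain ⟨x, hx⟩ := exists_mem_corner σ y.2 ((h y.1).1 (congrArg Subtype.val hy))
    exact ⟨x, Subtype.ext hx⟩
  · rintro ⟨x, rfl⟩
    exact Subtype.ext ((h _).2 ⟨x.1, rfl⟩)

/-- An isomorphism of modules restricts to an isomorphism of the corners. -/
noncomputable def cornerCongr (e : N ≃ₗ[Delta Λ] N') : corner σ N ≃ₗ[Λ] corner σ N' :=
  LinearEquiv.ofBijective (cornerMap σ e.toLinearMap)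
    ⟨cornerMap_injective σ e.injective, cornerMap_surjective σ e.surjective⟩

/-- The corner of a free module of rank `n` consists of the first rows of its entries, and is free
of rank `2 n`. -/
def cornerFreeEquiv (n : ℕ) : corner σ (Fin n → Delta Λ) ≃ₗ[Λ] (Fin n → Λ × Λ) where
  toFun x i := ((σ.symm (x.1 i)).a, (σ.symm (x.1 i)).n)
  map_add' x y := by
    funext i
    simp
  map_smul' c x := by
    funext i
    simp [corner_smul_coe]
  invFun y := ⟨fun i => σ ⟨(y i).1, (y i).2, 0, 0⟩, by
    change _ • _ = _
    funext i
    rw [Pi.smul_apply, smul_eq_mul, ← map_mul]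
    congr 1
    ext <;> simp⟩
  left_inv x := by
    refine Subtype.ext (funext fun i => ?_)
    have h : σ ⟨1, 0, 0, 0⟩ * x.1 i = x.1 i := congrFun x.2 i
    have h' : (⟨1, 0, 0, 0⟩ : Delta Λ) * σ.symm (x.1 i) = σ.symm (x.1 i) := by
      rw [← σ.symm_apply_apply ⟨1, 0, 0, 0⟩, ← map_mul, h]
    change σ ⟨(σ.symm (x.1 i)).a, (σ.symm (x.1 i)).n, 0, 0⟩ = x.1 i
    rw [← σ.eq_symm_apply, ← h']
    ext <;> simp
  right_inv y := by
    funext i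
    simp

theorem corner_finite_projective [Module.Finite (Delta Λ) N] [Module.Projective (Delta Λ) N] :
    Module.Finite Λ (corner σ N) ∧ Module.Projective Λ (corner σ N) := by
  obtain ⟨n, s, i, -, -, hsi⟩ := Module.Finite.exists_comp_eq_id_of_projective (Delta Λ) N
  have h : cornerMap σ s ∘ₗ cornerMap σ i = LinearMap.id :=
    LinearMap.ext fun x => Subtype.ext (LinearMap.congr_fun hsi x.1)
  have hF : Module.Finite Λ (corner σ (Fin n → Delta Λ)) :=
    Module.Finite.equiv (cornerFreeEquiv σ n).symm
  have hF' : Module.Projective Λ (corner σ (Fin n → Delta Λ)) :=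
    Module.Projective.of_equiv (cornerFreeEquiv σ n).symm
  exact ⟨Module.Finite.of_surjective (cornerMap σ s) fun x =>
      ⟨cornerMap σ i x, LinearMap.congr_fun h x⟩,
    Module.Projective.of_split _ _ h⟩

/-- The homomorphism `N ⟶ Δ₍₀,₀₎` coinduced from a functional on the corner of `N`. -/
def cornerToDelta (φ : corner σ N →ₗ[Λ] Λ) : N →ₗ[Delta Λ] Delta Λ where
  toFun x := σ ⟨0, φ ⟨_, smul_mem_corner σ 1 0 x⟩, 0, φ ⟨_, smul_mem_corner σ 0 1 x⟩⟩
  map_add' x y := by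
    rw [← map_add]
    congr 1
    have h : ∀ a n, (⟨_, smul_mem_corner σ a n (x + y)⟩ : corner σ N) =
        ⟨_, smul_mem_corner σ a n x⟩ + ⟨_, smul_mem_corner σ a n y⟩ := fun a n =>
      Subtype.ext (smul_add _ _ _)
    rw [h, h, map_add, map_add]
    ext <;> simp
  map_smul' s x := by
    obtain ⟨s, rfl⟩ := σ.surjective s
    rw [RingHom.id_apply, smul_eq_mul, ← map_mul]
    congr 1
    have h1 : (⟨_, smul_mem_corner σ 1 0 (σ s • x)⟩ : corner σ N) =
        s.a • ⟨_, smul_mem_corner σ 1 0 x⟩ + s.n • ⟨_, smul_mem_corner σ 0 1 x⟩ := by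
      refine Subtype.ext ?_
      change _ • _ • x = _ • _ • x + _ • _ • x
      simp only [smul_smul, ← map_mul, ← map_add, ← add_smul]
      congr 2
      ext <;> simp
    have h2 : (⟨_, smul_mem_corner σ 0 1 (σ s • x)⟩ : corner σ N) =
        s.b • ⟨_, smul_mem_corner σ 0 1 x⟩ := by
      refine Subtype.ext ?_
      change _ • _ • x = _ • _ • x
      simp only [smul_smul, ← map_mul]
      congr 2
      ext <;> simp
    rw [h1, h2]
    ext <;> simp

theorem cornerMap_functionalsExtend {φ : N →ₗ[Delta Λ] N'} (h : φ.FunctionalsExtend) :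
    (cornerMap σ φ).FunctionalsExtend := by
  intro α
  obtain ⟨ψ, hψ⟩ := h (cornerToDelta σ α)
  refine ⟨{ toFun := fun y => (σ.symm (ψ y.1)).n, map_add' := ?_, map_smul' := ?_ },
    LinearMap.ext fun x => ?_⟩
  · intro x y
    simp
  · intro c y
    simp [corner_smul_coe]
  · have h1 := congrArg (fun t => (σ.symm t).n) (LinearMap.congr_fun hψ x.1)
    refine h1.trans ?_
    change (σ.symm (σ _)).n = _
    rw [σ.symm_apply_apply]
    exact congrArg α (Subtype.ext x.2)

end Corner

/-- Passing to a corner is exact, preserves finitely generated projectives, and preserves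
`Hom`-exactness because `Δ₍₀,₀₎` is coinduced from its corner. -/
theorem projStep_corner (σ : Delta Λ ≃+* Delta Λ) {M N : Type u} [AddCommGroup M]
    [Module (Delta Λ) M] [AddCommGroup N] [Module (Delta Λ) N] (h : ProjStep (Delta Λ) M N) :
    ProjStep Λ (corner σ M) (corner σ N) := by
  obtain ⟨P, _, _, j, q, _, _, hj, hq, hjq, hext⟩ := h
  obtain ⟨hP, hP'⟩ := corner_finite_projective σ (N := P)
  exact ⟨corner σ P, _, _, cornerMap σ j, cornerMap σ q, hP, hP', cornerMap_injective σ hj,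
    cornerMap_surjective σ hq, cornerMap_exact σ hjq, cornerMap_functionalsExtend σ hext⟩

theorem isGorensteinProjective_corner (σ : Delta Λ ≃+* Delta Λ) {N : Type v} [AddCommGroup N]
    [Module (Delta Λ) N] (h : IsGorensteinProjective (Delta Λ) N) :
    IsGorensteinProjective Λ (corner σ N) := by
  obtain ⟨Z, i, hZ, ⟨e⟩⟩ := h.exists_chain
  exact (IsGorensteinProjective.of_chain_apply (fun i => ModuleCat.of Λ (corner σ (Z i)))
    (fun i => projStep_corner σ (hZ i)) i).congr (cornerCongr σ e)

end Delta

namespace DeltaTuple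

variable {Λ : Type u} [Ring Λ] {X : Type v} [AddCommGroup X] [Module Λ X]
  {Y : Type w} [AddCommGroup Y] [Module Λ Y] (T : DeltaTuple Λ X Y)

/-- The first component of a tuple is the corner of its module at `(1 0; 0 0)`. -/
def cornerFst : X ≃ₗ[Λ] Delta.corner (RingEquiv.refl (Delta Λ)) T.Carrier where
  toFun x := ⟨((x, 0) : X × Y), by
    change (((1 : Λ) • x + T.g ((0 : Λ) • (0 : Y)), (0 : Λ) • (0 : Y) + T.f ((0 : Λ) • x)) :
      X × Y) = (x, 0)
    simp⟩
  map_add' x y := Subtype.ext (Prod.ext rfl (add_zero (0 : Y)).symm)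
  map_smul' c x := by
    refine Subtype.ext ?_
    change ((c • x, 0) : X × Y) =
      (c • x + T.g ((0 : Λ) • (0 : Y)), (0 : Λ) • (0 : Y) + T.f ((0 : Λ) • x))
    simp
  invFun p := p.1.1
  left_inv _ := rfl
  right_inv p := by
    refine Subtype.ext (Prod.ext rfl ?_)
    have h : (0 : Λ) • p.1.2 + T.f ((0 : Λ) • p.1.1) = p.1.2 := congrArg Prod.snd p.2
    rw [← h]
    simp

/-- The second component of a tuple is the corner of its module at `(0 0; 0 1)`. -/
def cornerSnd : Y ≃ₗ[Λ] Delta.corner (Delta.swapEquiv Λ) T.Carrier where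
  toFun y := ⟨((0, y) : X × Y), by
    change (((0 : Λ) • (0 : X) + T.g ((0 : Λ) • y), (1 : Λ) • y + T.f ((0 : Λ) • (0 : X))) :
      X × Y) = (0, y)
    simp⟩
  map_add' x y := Subtype.ext (Prod.ext (add_zero (0 : X)).symm rfl)
  map_smul' c y := by
    refine Subtype.ext ?_
    change ((0, c • y) : X × Y) =
      ((0 : Λ) • (0 : X) + T.g ((0 : Λ) • y), c • y + T.f ((0 : Λ) • (0 : X)))
    simp
  invFun p := p.1.2
  left_inv _ := rfl
  right_inv p := by
    refine Subtype.ext (Prod.ext ?_ rfl)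
    have h : (0 : Λ) • p.1.1 + T.g ((0 : Λ) • p.1.2) = p.1.1 := congrArg Prod.fst p.2
    rw [← h]
    simp

/-- Gorenstein-projectivity is detected on the base of the Frobenius extension
`Λ × Λ ⟶ Δ₍₀,₀₎`. -/
theorem isGorensteinProjective_carrier_iff :
    IsGorensteinProjective (Delta Λ) T.Carrier ↔
      IsGorensteinProjective Λ X ∧ IsGorensteinProjective Λ Y :=
  ⟨fun h => ⟨(Delta.isGorensteinProjective_corner _ h).congr T.cornerFst,
    (Delta.isGorensteinProjective_corner _ h).congr T.cornerSnd⟩,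
    fun h => T.isGorensteinProjective_carrier h.1 h.2⟩

end DeltaTuple

theorem corollary3p12 (R : Type r) [CommRing R] [IsArtinianRing R]
    (Λ : Type u) [Ring Λ] [Algebra R Λ] [Module.Finite R Λ]
    (X : Type v) [AddCommGroup X] [Module Λ X] [Module.Finite Λ X]
    (Y : Type w) [AddCommGroup Y] [Module Λ Y] [Module.Finite Λ Y]
    (T : DeltaTuple Λ X Y)
    (hf : LinearMap.range T.f = LinearMap.ker T.g)
    (hg : LinearMap.range T.g = LinearMap.ker T.f)
    (hG : IsGorensteinProjective Λ (LinearMap.range T.f)) :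
    (IsGorensteinProjective (Delta Λ) T.Carrier ↔
      IsGorensteinProjective Λ X ∧ IsGorensteinProjective Λ Y) ∧
    (IsGorensteinProjective Λ X ∧ IsGorensteinProjective Λ Y ↔
      IsGorensteinProjective (Delta Λ) T.swap.Carrier) := by
  exact ⟨T.isGorensteinProjective_carrier_iff,
    and_comm.trans T.swap.isGorensteinProjective_carrier_iff.symm⟩
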